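/- Let $K$ be a field, let $N\subseteq K^\times$ be a subgroup of finite index containing $-1$, and let $\Gamma$ be a totally ordered group, written additively but not necessarily commutative. For a homomorphism $\varphi\colon N\to\Gamma$ and $\alpha\in\Gamma$ write $N_{>\alpha}=\{x\in N:\varphi(x)>\alpha\}$, and similarly $N_{\ge\alpha}$, $N_{\le\alpha}$. Let $\varphi\colon N\to\Gamma$ be a *strong valuation-like map*, i.e. a homomorphism for which there is $\alpha\in\Gamma$, $\alpha\ge 0$, such that $N_{>\alpha}\neq\emptyset$ and $$1\pm N_{>\alpha}\subseteq N_{\le 0}.$$ A *valuation* on $K$ is a surjective homomorphism $v\colon K^\times\to\Gamma_v$ onto a totally ordered group with $v(x+y)\ge\min(v(x),v(y))$ whenever $x+y\ne0$; its height is the height of $\Gamma_v$, i.e. the supremum of the lengths $r$ of chains $\Gamma_v=\Gamma_0\to\Gamma_1\to\cdots\to\Gamma_r=\{0\}$ of epimorphisms of totally ordered groups with non-trivial kernels. The valuation $v$ is *associated with* $\varphi$ if $\varphi(n)\ge0$ implies $v(n)\ge 0$ for all $n\in N$. Then there exists a non-trivial valuation $v$ on $K$ such that 1. $v$ is associated with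 $\varphi$, and $N$ is open in $K^\times$ in the $v$-adic topology; 2. if, additionally, $K$ has finite transcendence degree over its prime field, then $v$ has height one; 3. the subring $\mathcal R$ of $K$ generated by $N_{\ge0}$ is open in the $v$-adic topology on $K$. -/

import Mathlib

open Topology

universe u v

section LeveledMaps

variable {D : Type u} [DivisionRing D] {N : Subgroup Dˣ} {Γ : Type v} [AddGroup Γ]

/-- `α` is an s-level of the homomorphism `φ : N → Γ` to a partially ordered (additively written,
not necessarily commutative) group: `α ≥ 0`, the set `N_{>α}` is non-empty, and
`1 ± N_{>α} ⊆ N_{≤0}`. The inclusion says in particular that `1 ± x` is non-zero and lies in `N`. -/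
def IsSLevel [PartialOrder Γ] (φ : Additive N →+ Γ) (α : Γ) : Prop :=
  0 ≤ α ∧
  (∃ x : N, α < φ (.ofMul x)) ∧
  ∀ x : N, α < φ (.ofMul x) →
    (∃ y : N, ((y : Dˣ) : D) = 1 + ((x : Dˣ) : D) ∧ φ (.ofMul y) ≤ 0) ∧
    (∃ y : N, ((y : Dˣ) : D) = 1 - ((x : Dˣ) : D) ∧ φ (.ofMul y) ≤ 0)

/-- A strongly leveled map: a homomorphism to a partially ordered group that has an s-level. -/
def IsStronglyLeveled [PartialOrder Γ] (φ : Additive N →+ Γ) : Prop :=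
  ∃ α : Γ, IsSLevel φ α

/-- A strong valuation-like map: a strongly leveled map to a totally ordered group. -/
def IsStrongValuationLike [LinearOrder Γ] (φ : Additive N →+ Γ) : Prop :=
  IsStronglyLeveled φ

/-- The subring generated by `N_{≥0}`. -/
def nonnegSubring [PartialOrder Γ] (φ : Additive N →+ Γ) : Subring D :=
  Subring.closure {d : D | ∃ x : N, 0 ≤ φ (.ofMul x) ∧ ((x : Dˣ) : D) = d}

/-- The valuation `w` is associated with `φ`: if `φ(n) ≥ 0` then `w(n) ≥ 0`. Mathlib writes the
value group multiplicatively and with the reversed order, so the latter condition is `w n ≤ 1`. -/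
def IsAssociated [PartialOrder Γ] (φ : Additive N →+ Γ)
    {Γ₀ : Type*} [LinearOrderedCommGroupWithZero Γ₀] (w : Valuation D Γ₀) : Prop :=
  ∀ x : N, 0 ≤ φ (.ofMul x) → w ((x : Dˣ) : D) ≤ 1

end LeveledMaps

section AdicTopology

variable {K : Type u} [Field K] {Γ₀ : Type v} [LinearOrderedCommGroupWithZero Γ₀]

/-- The `w`-adic topology on `K`, for which the sets `{x | w x < γ}`, with `γ` in the value group,
form a fundamental system of neighbourhoods of zero. -/
@[reducible]
noncomputable def adicTopology (w : Valuation K Γ₀) : TopologicalSpace K :=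
  (Valued.mk' w).toUniformSpace.toTopologicalSpace

/-- The `w`-adic topology on the multiplicative group, induced from that of `K`. -/
@[reducible]
noncomputable def adicTopologyUnits (w : Valuation K Γ₀) : TopologicalSpace Kˣ :=
  (adicTopology w).induced (fun x : Kˣ => (x : K))

end AdicTopology

section Height

/-- There is a chain `Γ = Γ_0 → Γ_1 → ⋯ → Γ_r = 1` of `r` epimorphisms of totally ordered
commutative groups, each with non-trivial kernel. -/
def HasEpiChain : ℕ → ∀ (Γ : Type u) [CommGroup Γ] [LinearOrder Γ] [IsOrderedMonoid Γ], Prop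
  | 0, Γ, _, _, _ => Subsingleton Γ
  | r + 1, Γ, _, _, _ =>
    ∃ (Γ' : Type u) (_ : CommGroup Γ') (_ : LinearOrder Γ') (_ : IsOrderedMonoid Γ')
      (μ : Γ →* Γ'), Monotone μ ∧ Function.Surjective μ ∧ μ.ker ≠ ⊥ ∧ HasEpiChain r Γ'

/-- The height of a totally ordered commutative group: the supremum of the lengths of the chains
above. -/
noncomputable def groupHeight (Γ : Type u) [CommGroup Γ] [LinearOrder Γ] [IsOrderedMonoid Γ] : ℕ∞ :=
  ⨆ (r : ℕ) (_ : HasEpiChain r Γ), (r : ℕ∞)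

end Height

/-!
Let `R` be the ring generated by `N_{≥0}` and let `t ∈ N` have value beyond an s-level. Adding up
elements of `N_{≥0}` one at a time shows `1 + t R ⊆ N`, so `t⁻¹ ∉ R` and `R` is not a field, while
`Frac R = K` because the multiplicative group of a proper infinite subfield has infinite index. As
`N` has finite index, a power of `x` or of `x⁻¹` lies in `R` for every `x`. Hence the integral
closure of `R` is a valuation ring, and it is proper since an integral extension of `R` that is a
field would make `R` a field.

Every valuation whose ring contains `R` is associated with `φ`. Multiplying finitely many coset
representatives of `N` by a common denominator in `N` shows that `R` contains a ball around `0`,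
and `N`, a union of cosets of `1 + t R`, is then open as well.

The valuation ring just found may be replaced by any proper coarsening. One of height one exists
once the powers of some `y` of value less than `1` are cofinal near `0`. If there is no such `y`,
start from an `x` whose powers contain all values of the prime field and repeatedly choose an
element smaller than all powers of the previous one: each is transcendental over the field
generated by its predecessors, so the transcendence degree is infinite.
-/

section SLevel

section PartialOrder

variable {D : Type u} [DivisionRing D] {N : Subgroup Dˣ} {Γ : Type v} [AddGroup Γ]
  [PartialOrder Γ] {φ : Additive N →+ Γ} {α : Γ}

lemma coe_mem_nonnegSubring {x : N} (hx : 0 ≤ φ (.ofMul x)) :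
    ((x : Dˣ) : D) ∈ nonnegSubring φ :=
  Subring.subset_closure ⟨x, hx, rfl⟩

variable [AddLeftMono Γ]

lemma nonnegSubring_toAddSubgroup :
    (nonnegSubring φ).toAddSubgroup =
      AddSubgroup.closure {d : D | ∃ x : N, 0 ≤ φ (.ofMul x) ∧ ((x : Dˣ) : D) = d} := by
  let M : Submonoid D :=
    { carrier := {d | ∃ x : N, 0 ≤ φ (.ofMul x) ∧ ((x : Dˣ) : D) = d}
      one_mem' := ⟨1, by simp, by simp⟩
      mul_mem' := by
        rintro _ _ ⟨x, hx, rfl⟩ ⟨y, hy, rfl⟩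
        exact ⟨x * y, by simpa using add_nonneg hx hy, by simp⟩ }
  ext r
  change r ∈ Subring.closure (M : Set D) ↔ r ∈ AddSubgroup.closure (M : Set D)
  rw [Subring.mem_closure_iff, M.closure_eq]

namespace IsSLevel

lemma exists_one_add (h : IsSLevel φ α) {x : N} (hx : α < φ (.ofMul x)) :
    ∃ y : N, ((y : Dˣ) : D) = 1 + ((x : Dˣ) : D) ∧ φ (.ofMul y) = 0 := by
  obtain ⟨y, hy, hy0⟩ := (h.2.2 x hx).1
  have hxy : α < φ (.ofMul (x * y⁻¹)) := by
    simpa using hx.trans_le (le_add_of_nonneg_right (neg_nonneg.2 hy0))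
  obtain ⟨z, hz, hz0⟩ := (h.2.2 _ hxy).2
  have hzy : z = y⁻¹ := eq_inv_of_mul_eq_one_left <| by
    ext
    simpa [hz, sub_mul, sub_eq_iff_eq_add] using hy
  exact ⟨y, hy, hy0.antisymm (by simpa [hzy] using hz0)⟩

lemma exists_one_sub (h : IsSLevel φ α) {x : N} (hx : α < φ (.ofMul x)) :
    ∃ y : N, ((y : Dˣ) : D) = 1 - ((x : Dˣ) : D) ∧ φ (.ofMul y) = 0 := by
  obtain ⟨y, hy, hy0⟩ := (h.2.2 x hx).2
  have hxy : α < φ (.ofMul (x * y⁻¹)) := by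
    simpa using hx.trans_le (le_add_of_nonneg_right (neg_nonneg.2 hy0))
  obtain ⟨z, hz, hz0⟩ := (h.2.2 _ hxy).1
  have hzy : z = y⁻¹ := eq_inv_of_mul_eq_one_left <| by
    ext
    simpa [hz, add_mul, ← eq_sub_iff_add_eq] using hy
  exact ⟨y, hy, hy0.antisymm (by simpa [hzy] using hz0)⟩

-- `n` is arbitrary of value `0` rather than `1`, so that the summands of `r` are absorbed in turn.
lemma exists_add_and_exists_sub (h : IsSLevel φ α) {t n : N} (ht : α < φ (.ofMul t))
    (hn : φ (.ofMul n) = 0) {r : D} (hr : r ∈ nonnegSubring φ) :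
    (∃ y : N, ((y : Dˣ) : D) = (n : Dˣ) + (t : Dˣ) * r ∧ φ (.ofMul y) = 0) ∧
      ∃ y : N, ((y : Dˣ) : D) = (n : Dˣ) - (t : Dˣ) * r ∧ φ (.ofMul y) = 0 := by
  rw [← Subring.mem_toAddSubgroup, nonnegSubring_toAddSubgroup] at hr
  induction hr using AddSubgroup.closure_induction generalizing n with
  | mem _ hx =>
    obtain ⟨x, hx, rfl⟩ := hx
    have hlt : α < φ (.ofMul (n⁻¹ * (t * x))) := by
      simpa [hn] using ht.trans_le (le_add_of_nonneg_right hx)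
    obtain ⟨y, hy, hy0⟩ := h.exists_one_add hlt
    obtain ⟨z, hz, hz0⟩ := h.exists_one_sub hlt
    exact ⟨⟨n * y, by simp [hy, mul_add], by simp [hn, hy0]⟩,
      ⟨n * z, by simp [hz, mul_sub], by simp [hn, hz0]⟩⟩
  | zero => exact ⟨⟨n, by simp, hn⟩, ⟨n, by simp, hn⟩⟩
  | add r s _ _ ihr ihs =>
    obtain ⟨⟨y, hy, hy0⟩, z, hz, hz0⟩ := ihr hn
    obtain ⟨y', hy', hy0'⟩ := (ihs hy0).1
    obtain ⟨z', hz', hz0'⟩ := (ihs hz0).2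
    exact ⟨⟨y', by rw [hy', hy, mul_add, add_assoc], hy0'⟩,
      ⟨z', by rw [hz', hz, mul_add, sub_sub], hz0'⟩⟩
  | neg r _ ih =>
    simpa only [mul_neg, ← sub_eq_add_neg, sub_neg_eq_add] using (ih hn).symm

lemma exists_one_add_mul (h : IsSLevel φ α) {t : N} (ht : α < φ (.ofMul t)) {r : D}
    (hr : r ∈ nonnegSubring φ) : ∃ y : N, ((y : Dˣ) : D) = 1 + (t : Dˣ) * r := by
  obtain ⟨y, hy, -⟩ := (h.exists_add_and_exists_sub (n := 1) ht (by simp) hr).1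
  exact ⟨y, by simpa using hy⟩

lemma inv_notMem_nonnegSubring (h : IsSLevel φ α) {t : N} (ht : α < φ (.ofMul t)) :
    ((t : Dˣ) : D)⁻¹ ∉ nonnegSubring φ := by
  intro hr
  obtain ⟨y, hy⟩ := h.exists_one_add_mul ht (neg_mem hr)
  exact (y : Dˣ).ne_zero (by simp [hy])

lemma infinite (h : IsSLevel φ α) : Infinite N := by
  obtain ⟨t, ht⟩ := h.2.1
  have hmono : StrictMono fun k : ℕ => φ (.ofMul (t ^ k)) := strictMono_nat_of_lt_succ fun k => by
    simpa [pow_succ, succ_nsmul] using h.1.trans_lt ht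
  exact .of_injective (fun k : ℕ => t ^ k) fun a b hab =>
    hmono.injective (congrArg (fun x => φ (.ofMul x)) hab)

end IsSLevel

end PartialOrder

lemma coe_or_inv_mem_nonnegSubring {D : Type u} [DivisionRing D] {N : Subgroup Dˣ} {Γ : Type v}
    [AddGroup Γ] [LinearOrder Γ] [AddLeftMono Γ] (φ : Additive N →+ Γ) (x : N) :
    ((x : Dˣ) : D) ∈ nonnegSubring φ ∨ ((x : Dˣ) : D)⁻¹ ∈ nonnegSubring φ := by
  rcases le_total 0 (φ (.ofMul x)) with hx | hx
  · exact .inl (coe_mem_nonnegSubring hx)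
  · simpa using Or.inr (coe_mem_nonnegSubring (φ := φ) (x := x⁻¹) (by simpa using hx))

end SLevel

section FiniteIndex

theorem subfield_eq_top_of_finiteIndex {K : Type*} [DivisionRing K] (N : Subgroup Kˣ)
    [N.FiniteIndex] (F : Subfield K) [Infinite F] (hF : ∀ x ∈ N, (x : K) ∈ F) : F = ⊤ := by
  -- Over an infinite field, a space that is a finite union of lines is one of these lines.
  have hcover : ⋃ q : Kˣ ⧸ N, (Submodule.span F {((q.out⁻¹ : Kˣ) : K)} : Set K) = Set.univ := by
    refine Set.eq_univ_of_forall fun x => Set.mem_iUnion.2 ?_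
    rcases eq_or_ne x 0 with rfl | hx
    · exact ⟨(1 : Kˣ), zero_mem _⟩
    obtain ⟨n, hn⟩ := QuotientGroup.mk_out_eq_mul N (Units.mk0 x hx)⁻¹
    refine ⟨((Units.mk0 x hx)⁻¹ : Kˣ), Submodule.mem_span_singleton.2 ⟨⟨_, hF n n.2⟩, ?_⟩⟩
    simp [hn, Subfield.smul_def]
  obtain ⟨q, hq⟩ := Subspace.exists_eq_top_of_iUnion_eq_univ hcover
  obtain ⟨a, ha⟩ := Submodule.mem_span_singleton.1 (hq ▸ Submodule.mem_top : (1 : K) ∈ _)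
  have hc : ((q.out⁻¹ : Kˣ) : K) ∈ F := by
    rw [eq_inv_of_mul_eq_one_right ha]
    exact inv_mem a.2
  refine eq_top_iff.2 fun x _ => ?_
  obtain ⟨b, rfl⟩ := Submodule.mem_span_singleton.1 (hq ▸ Submodule.mem_top : x ∈ _)
  exact mul_mem b.2 hc

lemma exists_mem_forall_mul_mem_subring {K : Type*} [Field K] (N : Subgroup Kˣ)
    [N.FiniteIndex] (R : Subring K) [IsFractionRing R K] {ι : Type*} [Finite ι] (c : ι → K) :
    ∃ b ∈ N, ∀ i, (b : K) * c i ∈ R := by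
  obtain ⟨d, hd⟩ := IsLocalization.exist_integer_multiples_of_finite (nonZeroDivisors R) c
  have hd0 : (d : K) ≠ 0 := by simp
  refine ⟨Units.mk0 (d : K) hd0 ^ N.index, N.pow_index_mem _, fun i => ?_⟩
  obtain ⟨r, hr⟩ := hd i
  obtain ⟨k, hk⟩ := Nat.exists_eq_succ_of_ne_zero N.index_ne_zero_of_finite
  have hdc : (d : K) * c i ∈ R := by
    rw [show (d : K) * c i = r from hr.symm]
    exact r.2
  simpa [hk, pow_succ, mul_assoc] using mul_mem (pow_mem (d : R).2 k) hdc

theorem IsSLevel.isFractionRing_nonnegSubring {K : Type u} [Field K] {N : Subgroup Kˣ}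
    [N.FiniteIndex] {Γ : Type v} [AddGroup Γ] [LinearOrder Γ] [AddLeftMono Γ]
    {φ : Additive N →+ Γ} {α : Γ} (h : IsSLevel φ α) :
    IsFractionRing (nonnegSubring φ) K := by
  let F : Subfield K :=
    Subfield.closure {d : K | ∃ x : N, 0 ≤ φ (.ofMul x) ∧ ((x : Kˣ) : K) = d}
  have hRF : nonnegSubring φ ≤ F.toSubring := Subring.closure_le.2 Subfield.subset_closure
  have hNF : ∀ x ∈ N, (x : K) ∈ F := fun x hx =>
    (coe_or_inv_mem_nonnegSubring φ ⟨x, hx⟩).elim (fun h => hRF h)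
      fun h => inv_mem_iff.1 (hRF h)
  have := h.infinite
  have : Infinite F := .of_injective (fun x : N => (⟨(x : Kˣ), hNF x x.2⟩ : F)) fun x y hxy =>
    Subtype.ext (Units.ext (congrArg Subtype.val hxy))
  have hF : F = ⊤ := subfield_eq_top_of_finiteIndex N F hNF
  refine .of_field _ _ fun z => ?_
  obtain ⟨x, hx, y, hy, rfl⟩ := Subfield.mem_closure_iff.1 (hF ▸ Subfield.mem_top z : z ∈ F)
  exact ⟨⟨x, hx⟩, ⟨y, hy⟩, rfl⟩

end FiniteIndex

section Topology

lemma isOpen_adicTopology_of_ball_subset {K : Type u} [Field K] {Γ₀ : Type v}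
    [LinearOrderedCommGroupWithZero Γ₀] {w : Valuation K Γ₀} {H : AddSubgroup K} {c : K}
    (hc : c ≠ 0) (h : ∀ z, w z < w c → z ∈ H) : IsOpen[adicTopology w] (H : Set K) := by
  let : Valued K Γ₀ := Valued.mk' w
  refine AddSubgroup.isOpen_of_mem_nhds H (g := 0) (Valued.mem_nhds_zero.2 ?_)
  exact ⟨Units.mk0 (w.restrict c) (by simpa using hc),
    fun z hz => h z (w.restrict_lt_iff.1 hz)⟩

lemma IsAssociated.pos_of_lt_one {D : Type u} [DivisionRing D] {N : Subgroup Dˣ} {Γ : Type v}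
    [AddGroup Γ] [LinearOrder Γ] [AddLeftMono Γ] {φ : Additive N →+ Γ} {Γ₀ : Type*}
    [LinearOrderedCommGroupWithZero Γ₀] {w : Valuation D Γ₀} (hw : IsAssociated φ w) {x : N}
    (hx : w ((x : Dˣ) : D) < 1) : 0 < φ (.ofMul x) := by
  by_contra! hφ
  have hle : (w ((x : Dˣ) : D))⁻¹ ≤ 1 := by simpa using hw x⁻¹ (by simpa using hφ)
  exact hx.not_ge ((inv_le_one₀ (by simp [zero_lt_iff])).1 hle)

theorem IsAssociated.exists_ball_subset {K : Type u} [Field K] {N : Subgroup Kˣ} [N.FiniteIndex]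
    {Γ : Type v} [AddGroup Γ] [LinearOrder Γ] [AddLeftMono Γ] {φ : Additive N →+ Γ}
    [IsFractionRing (nonnegSubring φ) K] {Γ₀ : Type*} [LinearOrderedCommGroupWithZero Γ₀]
    {w : Valuation K Γ₀} (hw : IsAssociated φ w) :
    ∃ c : K, c ≠ 0 ∧ ∀ z, w z < w c → z ∈ nonnegSubring φ := by
  let rep (q : Kˣ ⧸ N) : Kˣ := q.out
  obtain ⟨b, hbN, hb⟩ := exists_mem_forall_mul_mem_subring N (nonnegSubring φ)
    fun q => (rep q : K)
  obtain ⟨q₀, hq₀⟩ := Finite.exists_min fun q => w (rep q)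
  refine ⟨b * rep q₀, by simp, fun z hz => ?_⟩
  rcases eq_or_ne z 0 with rfl | hz0
  · exact zero_mem _
  let q : Kˣ ⧸ N := Units.mk0 z hz0
  obtain ⟨n, hn⟩ := QuotientGroup.mk_out_eq_mul N (Units.mk0 z hz0)
  let m : N := (n * ⟨b, hbN⟩)⁻¹
  have hz_eq : z = ((m : Kˣ) : K) * (b * rep q) := by
    have hunits : Units.mk0 z hz0 = m * (b * rep q) := by
      change Units.mk0 z hz0 = (n * b : Kˣ)⁻¹ * (b * q.out)
      rw [hn, eq_inv_mul_iff_mul_eq]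
      ac_rfl
    exact congrArg Units.val hunits
  have hm : w ((m : Kˣ) : K) < 1 := by
    refine lt_of_mul_lt_mul_right (a := w (b * rep q)) ?_ zero_le
    rw [← map_mul, ← hz_eq, one_mul, map_mul]
    rw [map_mul] at hz
    exact hz.trans_le (by gcongr; exact hq₀ q)
  rw [hz_eq]
  exact mul_mem (coe_mem_nonnegSubring (hw.pos_of_lt_one hm).le) (hb q)

theorem IsSLevel.isOpen_induced {D : Type u} [DivisionRing D] [TopologicalSpace D]
    [IsTopologicalRing D] {N : Subgroup Dˣ} {Γ : Type v} [AddGroup Γ] [PartialOrder Γ]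
    [AddLeftMono Γ] {φ : Additive N →+ Γ} {α : Γ} (h : IsSLevel φ α)
    (hR : IsOpen (nonnegSubring φ : Set D)) :
    IsOpen[.induced (fun x : Dˣ => (x : D)) inferInstance] (N : Set Dˣ) := by
  obtain ⟨t, ht⟩ := h.2.1
  let f (n : N) (x : D) : D := ((t⁻¹ : N) : Dˣ) * (((n⁻¹ : N) : Dˣ) * x - 1)
  -- The preimage of `R` under `f n` is the neighbourhood `n (1 + t R)` of `n`.
  refine isOpen_induced_iff.2 ⟨⋃ n : N, f n ⁻¹' nonnegSubring φ,
    isOpen_iUnion fun n => hR.preimage (by fun_prop), Set.ext fun x => ?_⟩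
  simp only [Set.mem_preimage, Set.mem_iUnion, SetLike.mem_coe]
  refine ⟨fun ⟨n, hn⟩ => ?_, fun hx => ⟨⟨x, hx⟩, by simp [f, zero_mem]⟩⟩
  obtain ⟨y, hy⟩ := h.exists_one_add_mul ht hn
  have hxy : x = n * y := by
    ext
    simp [hy, f]
  rw [hxy]
  exact mul_mem n.2 y.2

end Topology

section IntegralClosure

variable {K : Type*} [Field K] {R : Subring K}

/-- The integral closure in `K` of a subring `R`, as a valuation ring. It is one as soon as `R`
contains, for every `x`, a positive power of `x` or of `x⁻¹`. -/
noncomputable def integralValuationSubring (R : Subring K)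
    (hR : ∀ x : K, ∃ m ≠ 0, x ^ m ∈ R ∨ x⁻¹ ^ m ∈ R) : ValuationSubring K where
  __ := (integralClosure R K).toSubring
  mem_or_inv_mem' x := by
    have isIntegral_of_pow_mem {y : K} {m : ℕ} (hm : m ≠ 0) (hy : y ^ m ∈ R) : IsIntegral R y :=
      .of_pow (Nat.pos_of_ne_zero hm) (isIntegral_algebraMap (x := (⟨_, hy⟩ : R)))
    obtain ⟨m, hm, hx⟩ := hR x
    exact hx.imp (isIntegral_of_pow_mem hm) (isIntegral_of_pow_mem hm)

lemma le_integralValuationSubring (hR : ∀ x : K, ∃ m ≠ 0, x ^ m ∈ R ∨ x⁻¹ ^ m ∈ R) :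
    R ≤ (integralValuationSubring R hR).toSubring :=
  fun r hr => isIntegral_algebraMap (x := (⟨r, hr⟩ : R))

lemma integralValuationSubring_ne_top (hR : ∀ x : K, ∃ m ≠ 0, x ^ m ∈ R ∨ x⁻¹ ^ m ∈ R)
    (hfield : ¬ IsField R) : integralValuationSubring R hR ≠ ⊤ := by
  intro htop
  have : Algebra.IsIntegral R K :=
    ⟨fun x => show x ∈ integralValuationSubring R hR from htop ▸ ValuationSubring.mem_top x⟩
  exact hfield <| isField_of_isIntegral_of_isField (FaithfulSMul.algebraMap_injective R K)
    (Field.toIsField K)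

end IntegralClosure

lemma IsSLevel.not_isField_nonnegSubring {D : Type u} [DivisionRing D] {N : Subgroup Dˣ}
    {Γ : Type v} [AddGroup Γ] [PartialOrder Γ] [AddLeftMono Γ] {φ : Additive N →+ Γ} {α : Γ}
    (h : IsSLevel φ α) : ¬ IsField (nonnegSubring φ) := by
  intro hfield
  obtain ⟨t, ht⟩ := h.2.1
  obtain ⟨s, hs⟩ := hfield.mul_inv_cancel
    (a := ⟨_, coe_mem_nonnegSubring (h.1.trans ht.le)⟩) (by simp [Subtype.ext_iff])
  refine h.inv_notMem_nonnegSubring ht ?_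
  rw [← eq_inv_of_mul_eq_one_right (congrArg Subtype.val hs)]
  exact s.2

lemma exists_pow_mem_nonnegSubring {D : Type u} [DivisionRing D] {N : Subgroup Dˣ}
    [N.Normal] [N.FiniteIndex] {Γ : Type v} [AddGroup Γ] [LinearOrder Γ] [AddLeftMono Γ]
    (φ : Additive N →+ Γ) (x : D) :
    ∃ m ≠ 0, x ^ m ∈ nonnegSubring φ ∨ x⁻¹ ^ m ∈ nonnegSubring φ := by
  refine ⟨N.index, N.index_ne_zero_of_finite, ?_⟩
  rcases eq_or_ne x 0 with rfl | hx
  · exact .inl (by simp [N.index_ne_zero_of_finite, zero_mem])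
  · simpa using coe_or_inv_mem_nonnegSubring φ
      ⟨Units.mk0 x hx ^ N.index, N.pow_index_mem (Units.mk0 x hx)⟩

section Height

lemma HasEpiChain.eq_zero_of_subsingleton {r : ℕ} {Γ : Type u} [CommGroup Γ] [LinearOrder Γ]
    [IsOrderedMonoid Γ] [Subsingleton Γ] (h : HasEpiChain r Γ) : r = 0 := by
  cases r with
  | zero => rfl
  | succ r =>
    obtain ⟨Γ', _, _, _, μ, -, -, hker, -⟩ := h
    exact absurd (Subsingleton.elim _ _) hker

lemma eq_one_of_monotone_of_ker_ne_bot {Γ Γ' : Type*} [CommGroup Γ] [LinearOrder Γ]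
    [IsOrderedMonoid Γ] [MulArchimedean Γ] [CommGroup Γ'] [PartialOrder Γ'] [IsOrderedMonoid Γ']
    {μ : Γ →* Γ'} (hμ : Monotone μ) (hker : μ.ker ≠ ⊥) : μ = 1 := by
  obtain ⟨g, hg, hg1⟩ := μ.ker.bot_or_exists_ne_one.resolve_left hker
  have hle (f : Γ) : μ f ≤ 1 := by
    obtain ⟨n, hn⟩ := MulArchimedean.arch f (one_lt_mabs.2 hg1)
    calc μ f ≤ μ (|g|ₘ ^ n) := hμ hn
      _ = 1 := pow_mem (mabs_mem_iff.2 hg) n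
  ext f
  exact (hle f).antisymm (by simpa using hle f⁻¹)

theorem groupHeight_eq_one (Γ : Type u) [CommGroup Γ] [LinearOrder Γ] [IsOrderedMonoid Γ]
    [Nontrivial Γ] [MulArchimedean Γ] : groupHeight Γ = 1 := by
  refine le_antisymm (iSup₂_le fun r hr => ?_) ?_
  · cases r with
    | zero => simp
    | succ r =>
      obtain ⟨Γ', _, _, _, μ, hmono, hsurj, hker, hr⟩ := hr
      obtain rfl := eq_one_of_monotone_of_ker_ne_bot hmono hker
      have : Subsingleton Γ' := ⟨hsurj.forall₂.2 fun _ _ => rfl⟩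
      simp [hr.eq_zero_of_subsingleton]
  · have hpunit : IsOrderedMonoid PUnit.{u + 1} := { mul_le_mul_left := fun _ _ _ _ => le_rfl }
    refine le_iSup₂_of_le 1 ⟨PUnit, inferInstance, inferInstance, hpunit, 1, monotone_const,
      fun _ => ⟨1, rfl⟩, by simp, inferInstanceAs (Subsingleton PUnit)⟩ (by simp)

end Height

section Coarsening

variable {K : Type*} [Field K] {A : ValuationSubring K} {x : K}

/-- The complete integral closure of a valuation ring `A` in `K`: the coarsening of `A` of height
one if there is one, and `K` otherwise. -/
noncomputable def archimedeanCoarsening (A : ValuationSubring K) : ValuationSubring K :=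
  A.ofLE (completeIntegralClosure A K).toSubring fun x hx =>
    (completeIntegralClosure A K).algebraMap_mem ⟨x, hx⟩

lemma le_archimedeanCoarsening (A : ValuationSubring K) : A ≤ archimedeanCoarsening A :=
  fun x hx => (completeIntegralClosure A K).algebraMap_mem ⟨x, hx⟩

lemma mem_archimedeanCoarsening :
    x ∈ archimedeanCoarsening A ↔ ∃ r ≠ 0, ∀ n : ℕ, A.valuation (r * x ^ n) ≤ 1 := by
  change IsAlmostIntegral A x ↔ _
  constructor
  · rintro ⟨r, hr, h⟩
    refine ⟨r, by simpa using hr, fun n => ?_⟩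
    obtain ⟨a, ha⟩ := h n
    exact by simpa [Algebra.smul_def] using (A.valuation_le_one_iff _).2 (ha ▸ a.2 : r • x ^ n ∈ A)
  · rintro ⟨r, hr, h⟩
    have hrA : r ∈ A := by simpa using (A.valuation_le_one_iff _).1 (h 0)
    exact ⟨⟨r, hrA⟩, by simpa [Subtype.ext_iff] using hr,
      fun n => ⟨⟨_, (A.valuation_le_one_iff _).1 (h n)⟩, rfl⟩⟩

instance mulArchimedean_valueGroup_archimedeanCoarsening (A : ValuationSubring K) :
    MulArchimedean (archimedeanCoarsening A).ValueGroup where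
  arch a b hb := by
    have hsurj := (archimedeanCoarsening A).valuation_surjective
    obtain ⟨⟨x, rfl⟩, y, rfl⟩ := And.intro (hsurj a) (hsurj b)
    rcases eq_or_ne x 0 with rfl | hx
    · exact ⟨0, by simp⟩
    have hy : y ∉ archimedeanCoarsening A := fun h =>
      hb.not_ge ((ValuationSubring.valuation_le_one_iff _ y).2 h)
    have hy0 : y ≠ 0 := by rintro rfl; exact hy (zero_mem _)
    obtain ⟨n, hn⟩ : ∃ n : ℕ, 1 < A.valuation (x⁻¹ * y ^ n) := by
      by_contra! h
      exact hy (mem_archimedeanCoarsening.2 ⟨x⁻¹, inv_ne_zero hx, h⟩)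
    have hA : x / y ^ n ∈ A := by
      rw [← A.valuation_le_one_iff, ← inv_inv (x / y ^ n), inv_div, div_eq_inv_mul, map_inv₀]
      exact inv_le_one_of_one_le₀ hn.le
    refine ⟨n, ?_⟩
    rw [← map_pow, ← div_le_one₀ (by simp [zero_lt_iff, hy0]), ← map_div₀]
    exact (ValuationSubring.valuation_le_one_iff _ _).2 (le_archimedeanCoarsening A hA)

lemma archimedeanCoarsening_ne_top {y : K} (hy0 : y ≠ 0) (hy : A.valuation y < 1)
    (hcofinal : ∀ z ≠ 0, ∃ k : ℕ, A.valuation (y ^ k) ≤ A.valuation z) :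
    archimedeanCoarsening A ≠ ⊤ := by
  intro htop
  obtain ⟨r, hr, h⟩ := mem_archimedeanCoarsening.1
    (htop ▸ ValuationSubring.mem_top y⁻¹ : y⁻¹ ∈ archimedeanCoarsening A)
  obtain ⟨k, hk⟩ := hcofinal r hr
  have hlt : A.valuation (y ^ (k + 1)) < A.valuation r := by
    rw [pow_succ, map_mul]
    exact (mul_lt_of_lt_one_right (by simp [zero_lt_iff, hy0]) hy).trans_le hk
  refine (h (k + 1)).not_gt ?_
  rwa [inv_pow, ← div_eq_mul_inv, map_div₀, one_lt_div₀ (by simp [zero_lt_iff, hy0])]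

lemma groupHeight_units_valueGroup {B : ValuationSubring K} (hB : B ≠ ⊤)
    [MulArchimedean B.ValueGroup] : groupHeight B.ValueGroupˣ = 1 := by
  have hnontrivial : B.valuation.IsNontrivial := not_not.1 fun h => hB (B.eq_top_iff.2 h)
  obtain ⟨x, hx⟩ := Valuation.isNontrivial_iff_exists_unit.1 hnontrivial
  have : Nontrivial B.ValueGroupˣ :=
    ⟨Units.mk0 (B.valuation x) (by simp), 1, by simpa [Units.ext_iff] using hx⟩
  exact groupHeight_eq_one _

end Coarsening

section TranscendenceDegree

open IntermediateField Polynomial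

variable {K : Type u} [Field K] {Γ₀ : Type*} [LinearOrderedCommGroupWithZero Γ₀]
  {w : Valuation K Γ₀}

/-- `z` is infinitesimally small over the field `F`, as measured by `w`: it is non-zero, and closer
to zero than every non-zero element of `F`. -/
def IsInfinitesimalOver (w : Valuation K Γ₀) (F : Type*) [Field F] [Algebra F K] (z : K) : Prop :=
  z ≠ 0 ∧ ∀ a : F, a ≠ 0 → w z < w (algebraMap F K a)

namespace IsInfinitesimalOver

section

variable {F : Type*} [Field F] [Algebra F K] {y z : K}

lemma lt_one (hz : IsInfinitesimalOver w F z) : w z < 1 := by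
  simpa using hz.2 1 one_ne_zero

lemma pos (hz : IsInfinitesimalOver w F z) : 0 < w z := by
  simpa [zero_lt_iff] using hz.1

lemma exists_map_aeval_eq (hz : IsInfinitesimalOver w F z) {p : F[X]} (hp : p ≠ 0) :
    ∃ m : ℕ, ∃ a : F, a ≠ 0 ∧ w (aeval z p) = w (algebraMap F K a) * w z ^ m := by
  classical
  have ha : p.trailingCoeff ≠ 0 := trailingCoeff_nonzero_iff_nonzero.2 hp
  refine ⟨p.natTrailingDegree, p.trailingCoeff, ha, ?_⟩
  rw [aeval_def, eval₂_eq_sum, sum_def,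
    w.map_sum_eq_of_lt (natTrailingDegree_mem_support_of_nonzero hp), map_mul, map_pow]
  · rfl
  intro i hi
  rw [Finset.mem_sdiff, Finset.mem_singleton] at hi
  have hb : p.coeff i ≠ 0 := mem_support_iff.1 hi.1
  obtain ⟨k, hk⟩ := Nat.exists_eq_add_of_lt
    ((natTrailingDegree_le_of_mem_supp i hi.1).lt_of_ne (Ne.symm hi.2))
  have hlt : w (algebraMap F K (p.coeff i)) * w z < w (algebraMap F K p.trailingCoeff) := by
    have := hz.2 (p.trailingCoeff / p.coeff i) (div_ne_zero ha hb)
    rwa [map_div₀, map_div₀, lt_div_iff₀' (by simpa [zero_lt_iff] using hb)] at this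
  have hpos : 0 < w z ^ p.natTrailingDegree := pow_pos hz.pos _
  calc w (algebraMap F K (p.coeff i) * z ^ i)
      = w (algebraMap F K (p.coeff i)) * w z * w z ^ p.natTrailingDegree * w z ^ k := by
        rw [map_mul, map_pow, mul_assoc, mul_assoc, ← pow_add, ← pow_succ', hk, add_assoc]
    _ ≤ w (algebraMap F K (p.coeff i)) * w z * w z ^ p.natTrailingDegree :=
        mul_le_of_le_one_right' (pow_le_one' hz.lt_one.le k)
    _ < w (algebraMap F K p.trailingCoeff) * w z ^ p.natTrailingDegree := by gcongr
    _ = w (algebraMap F K (p.coeff p.natTrailingDegree) * z ^ p.natTrailingDegree) := by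
        rw [map_mul, map_pow, trailingCoeff]

theorem transcendental (hz : IsInfinitesimalOver w F z) : Transcendental F z := by
  refine transcendental_iff.2 fun p hp => by_contra fun hp0 => ?_
  obtain ⟨m, a, ha, hw⟩ := hz.exists_map_aeval_eq hp0
  simp [hp, ha, hz.1] at hw

lemma exists_map_eq_of_mem_adjoin (hz : IsInfinitesimalOver w F z) {x : K} (hx : x ∈ F⟮z⟯)
    (hx0 : x ≠ 0) : ∃ j : ℤ, ∃ a : F, a ≠ 0 ∧ w x = w (algebraMap F K a) * w z ^ j := by
  obtain ⟨p, q, rfl⟩ := (mem_adjoin_simple_iff F x).1 hx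
  obtain ⟨hp, hq⟩ := div_ne_zero_iff.1 hx0
  obtain ⟨m, a, ha, hwp⟩ := hz.exists_map_aeval_eq (ne_zero_of_map hp)
  obtain ⟨n, b, hb, hwq⟩ := hz.exists_map_aeval_eq (ne_zero_of_map hq)
  refine ⟨m - n, a / b, div_ne_zero ha hb, ?_⟩
  simp only [map_div₀, hwp, hwq, zpow_sub₀ hz.pos.ne', zpow_natCast]
  exact mul_div_mul_comm ..

lemma adjoin_simple (hy : IsInfinitesimalOver w F y) (hz0 : z ≠ 0)
    (hz : ∀ k : ℕ, w z < w y ^ k) : IsInfinitesimalOver w F⟮y⟯ z := by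
  refine ⟨hz0, fun x hx => ?_⟩
  obtain ⟨j, a, ha, hw⟩ := hy.exists_map_eq_of_mem_adjoin x.2 (by simpa using hx)
  calc w z < w y ^ (j.toNat + 1) := hz _
    _ = w y * w y ^ (j.toNat : ℤ) := by rw [pow_succ', zpow_natCast]
    _ ≤ w (algebraMap F K a) * w y ^ j :=
        mul_le_mul' (hy.2 a ha).le
          (zpow_right_anti₀ hy.pos hy.lt_one.le (Int.self_le_toNat j))
    _ = w (algebraMap F⟮y⟯ K x) := hw.symm

end

theorem aleph0_le_trdeg {F : Type u} [Field F] [Algebra F K] {y : K}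
    (hy : IsInfinitesimalOver w F y)
    (hw : ∀ y ≠ 0, w y < 1 → ∃ z ≠ 0, ∀ k : ℕ, w z < w y ^ k) :
    Cardinal.aleph0 ≤ Algebra.trdeg F K := by
  refine Cardinal.aleph0_le.2 fun n => ?_
  induction n generalizing F y with
  | zero => simp
  | succ n ih =>
    obtain ⟨z, hz0, hz⟩ := hw y hy.1 hy.lt_one
    have hn : (n : Cardinal) ≤ Algebra.trdeg F⟮y⟯ K := ih (hy.adjoin_simple hz0 hz)
    have hone : 1 ≤ Algebra.trdeg F F⟮y⟯ := by
      rw [Cardinal.one_le_iff_ne_zero, trdeg_ne_zero_iff]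
      exact ⟨AdjoinSimple.gen F y, (transcendental_algebraMap_iff
        (FaithfulSMul.algebraMap_injective F⟮y⟯ K)).1 hy.transcendental⟩
    calc ((n + 1 : ℕ) : Cardinal) = 1 + n := by rw [Nat.cast_succ, add_comm]
      _ ≤ Algebra.trdeg F F⟮y⟯ + Algebra.trdeg F⟮y⟯ K := add_le_add hone hn
      _ ≤ Algebra.trdeg F K := trdeg_add_le

end IsInfinitesimalOver

lemma valuation_intCast_lt_one_iff (w : Valuation K Γ₀) (p : ℕ)
    [CharP (IsLocalRing.ResidueField w.valuationSubring) p] (n : ℤ) :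
    w (n : K) < 1 ↔ (p : ℤ) ∣ n := by
  rw [← CharP.intCast_eq_zero_iff (IsLocalRing.ResidueField w.valuationSubring) p n,
    ← map_intCast (IsLocalRing.residue w.valuationSubring), IsLocalRing.residue_eq_zero_iff,
    Valuation.mem_maximalIdeal_iff]
  simp

lemma exists_forall_map_intCast_eq_pow (w : Valuation K Γ₀) [w.IsNontrivial] :
    ∃ x ≠ 0, w x < 1 ∧ ∀ n : ℤ, (n : K) ≠ 0 → ∃ e : ℕ, w (n : K) = w x ^ e := by
  let p := ringChar (IsLocalRing.ResidueField w.valuationSubring)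
  have hdvd := valuation_intCast_lt_one_iff w p
  have map_eq_one {n : ℤ} (hn : ¬ (p : ℤ) ∣ n) : w (n : K) = 1 := by
    exact le_antisymm ((Valuation.mem_valuationSubring_iff ..).1 (intCast_mem w.valuationSubring n))
      (not_lt.1 (mt (hdvd n).1 hn))
  by_cases hp : (p : K) = 0
  · obtain ⟨x, hx0, hx⟩ := Valuation.IsNontrivial.exists_lt_one (v := w)
    refine ⟨x, hx0, hx, fun n hn => ⟨0, ?_⟩⟩
    rw [pow_zero]
    refine map_eq_one fun ⟨c, hc⟩ => hn ?_
    simp [hc, hp]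
  · refine ⟨p, hp, by simpa using (hdvd p).2 dvd_rfl, fun n hn => ?_⟩
    have hp1 : p ≠ 1 := CharP.ringChar_ne_one
    have hfin : FiniteMultiplicity (p : ℤ) n :=
      Int.finiteMultiplicity_iff.2 ⟨by simpa using hp1, by rintro rfl; simp at hn⟩
    obtain ⟨c, hc, hpc⟩ := hfin.exists_eq_pow_mul_and_not_dvd
    refine ⟨multiplicity (p : ℤ) n, ?_⟩
    calc w (n : K) = w ((p : K) ^ multiplicity (p : ℤ) n * (c : K)) := by
          conv_lhs => rw [hc]
          push_cast; rfl
      _ = w p ^ multiplicity (p : ℤ) n := by rw [map_mul, map_pow, map_eq_one hpc, mul_one]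

lemma exists_forall_map_eq_zpow (w : Valuation K Γ₀) [w.IsNontrivial] :
    ∃ x ≠ 0, w x < 1 ∧ ∀ a ∈ (⊥ : Subfield K), a ≠ 0 → ∃ j : ℤ, w a = w x ^ j := by
  obtain ⟨x, hx0, hx, hint⟩ := exists_forall_map_intCast_eq_pow w
  refine ⟨x, hx0, hx, fun a ha ha0 => ?_⟩
  rw [← Subfield.closure_empty, Subfield.mem_closure_iff, Subring.closure_empty] at ha
  obtain ⟨_, ⟨m, rfl⟩, _, ⟨n, rfl⟩, rfl⟩ := ha
  obtain ⟨hm, hn⟩ := div_ne_zero_iff.1 ha0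
  obtain ⟨i, hi⟩ := hint m (by simpa using hm)
  obtain ⟨j, hj⟩ := hint n (by simpa using hn)
  refine ⟨i - j, ?_⟩
  simp [zpow_sub₀, hx0, hi, hj]

-- Otherwise some `z₁` is infinitesimal over the prime field, some `z₂` over the field generated by
-- `z₁`, and so on; each step raises the transcendence degree.
theorem exists_forall_pow_le_of_trdeg_lt_aleph0 (w : Valuation K Γ₀) [w.IsNontrivial]
    (htrdeg : Algebra.trdeg (⊥ : Subfield K) K < Cardinal.aleph0) :
    ∃ y ≠ 0, w y < 1 ∧ ∀ z ≠ 0, ∃ k : ℕ, w y ^ k ≤ w z := by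
  by_contra! hw
  obtain ⟨x, hx0, hx, hprime⟩ := exists_forall_map_eq_zpow w
  obtain ⟨z, hz0, hz⟩ := hw x hx0 hx
  have hinf : IsInfinitesimalOver w (⊥ : Subfield K) z := by
    refine ⟨hz0, fun a ha => ?_⟩
    obtain ⟨j, hj⟩ := hprime a a.2 (by simpa using ha)
    calc w z < w x ^ (j.toNat : ℤ) := by rw [zpow_natCast]; exact hz _
      _ ≤ w x ^ j :=
          zpow_right_anti₀ (by simpa [zero_lt_iff] using hx0) hx.le (Int.self_le_toNat j)
      _ = w (algebraMap (⊥ : Subfield K) K a) := hj.symm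
  exact htrdeg.not_ge (hinf.aleph0_le_trdeg hw)

end TranscendenceDegree

lemma exists_le_ne_top_groupHeight_eq_one {K : Type*} [Field K] (A : ValuationSubring K)
    (hA : A ≠ ⊤) : ∃ B, A ≤ B ∧ B ≠ ⊤ ∧
      (Algebra.trdeg (⊥ : Subfield K) K < Cardinal.aleph0 → groupHeight B.ValueGroupˣ = 1) := by
  by_cases htrdeg : Algebra.trdeg (⊥ : Subfield K) K < Cardinal.aleph0
  · have : A.valuation.IsNontrivial := not_not.1 fun h => hA (A.eq_top_iff.2 h)
    obtain ⟨y, hy0, hy, hcofinal⟩ := exists_forall_pow_le_of_trdeg_lt_aleph0 A.valuation htrdeg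
    have hB := archimedeanCoarsening_ne_top hy0 hy (by simpa only [map_pow] using hcofinal)
    exact ⟨_, le_archimedeanCoarsening A, hB, fun _ => groupHeight_units_valueGroup hB⟩
  · exact ⟨A, le_rfl, hA, fun h => absurd h htrdeg⟩

lemma isAssociated_valuation_of_nonnegSubring_le {K : Type u} [Field K] {N : Subgroup Kˣ}
    {Γ : Type v} [AddGroup Γ] [PartialOrder Γ] {φ : Additive N →+ Γ} {B : ValuationSubring K}
    (hB : nonnegSubring φ ≤ B.toSubring) : IsAssociated φ B.valuation :=
  fun _ hx => (B.valuation_le_one_iff _).2 (hB (coe_mem_nonnegSubring hx))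

theorem mainTheorem6_general {K : Type u} [Field K] (N : Subgroup Kˣ) [N.FiniteIndex]
    {Γ : Type v} [AddGroup Γ] [LinearOrder Γ] [AddLeftMono Γ]
    (φ : Additive N →+ Γ) (hφ : IsStrongValuationLike φ) :
    ∃ (Γ₀ : Type u) (_ : LinearOrderedCommGroupWithZero Γ₀) (w : Valuation K Γ₀),
      Function.Surjective w ∧
      w.IsNontrivial ∧
      IsAssociated φ w ∧
      IsOpen[adicTopologyUnits w] (N : Set Kˣ) ∧
      (Algebra.trdeg (⊥ : Subfield K) K < Cardinal.aleph0 → groupHeight Γ₀ˣ = 1) ∧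
      IsOpen[adicTopology w] (nonnegSubring φ : Set K) := by
  obtain ⟨α, hα⟩ := hφ
  have : IsFractionRing (nonnegSubring φ) K := hα.isFractionRing_nonnegSubring
  have hpow := exists_pow_mem_nonnegSubring φ
  obtain ⟨B, hAB, hB, hheight⟩ := exists_le_ne_top_groupHeight_eq_one
    (integralValuationSubring (nonnegSubring φ) hpow)
    (integralValuationSubring_ne_top hpow hα.not_isField_nonnegSubring)
  have hassoc : IsAssociated φ B.valuation :=
    isAssociated_valuation_of_nonnegSubring_le ((le_integralValuationSubring hpow).trans hAB)
  obtain ⟨c, hc, hball⟩ := hassoc.exists_ball_subset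
  have hR : IsOpen[adicTopology B.valuation] (nonnegSubring φ : Set K) :=
    isOpen_adicTopology_of_ball_subset (H := (nonnegSubring φ).toAddSubgroup) hc hball
  have hN : IsOpen[adicTopologyUnits B.valuation] (N : Set Kˣ) :=
    letI := Valued.mk' B.valuation
    hα.isOpen_induced hR
  exact ⟨B.ValueGroup, inferInstance, B.valuation, B.valuation_surjective,
    not_not.1 fun h => hB (B.eq_top_iff.2 h), hassoc, hN, hheight, hR⟩

theorem mainTheorem6 {K : Type u} [Field K] (N : Subgroup Kˣ) [N.FiniteIndex]
    (hN : (-1 : Kˣ) ∈ N)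
    {Γ : Type v} [AddGroup Γ] [LinearOrder Γ] [AddLeftMono Γ] [AddRightMono Γ]
    (φ : Additive N →+ Γ) (hφ : IsStrongValuationLike φ) :
    ∃ (Γ₀ : Type u) (_ : LinearOrderedCommGroupWithZero Γ₀) (w : Valuation K Γ₀),
      Function.Surjective w ∧
      w.IsNontrivial ∧
      IsAssociated φ w ∧
      IsOpen[adicTopologyUnits w] (N : Set Kˣ) ∧
      (Algebra.trdeg (⊥ : Subfield K) K < Cardinal.aleph0 → groupHeight Γ₀ˣ = 1) ∧
      IsOpen[adicTopology w] (nonnegSubring φ : Set K) :=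
  mainTheorem6_general N φ hφ
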